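/- Let $m\ge 2$ and let $(X_n)_{n\ge 0}$ be an irreducible, aperiodic, homogeneous Markov chain on the ordered alphabet $\{1<2<\dots<m\}$ with transition matrix $P$ and stationary distribution $(\pi_1,\dots,\pi_m)$, started from its stationary distribution. For a letter $a$ and $k\ge 0$ let $T^a_k=\#\{1\le i\le k: X_i=a\}-\pi_a k$, and let $\Sigma=(\sigma_{a,b})$ be the asymptotic covariance matrix, $\sigma_{a,b}=\lim_{k\to\infty}\mathrm{Cov}(T^a_k,T^b_k)/k$; put $\sigma_a=\sqrt{\sigma_{a,a}}$. Let $\tilde B=(\tilde B^1,\dots,\tilde B^m)$ be an $m$-dimensional Brownian motion on $[0,1]$ (a continuous centered Gaussian process) with $\mathrm{Cov}(\tilde B^a(s),\tilde B^b(t))=\min(s,t)\,\sigma_{a,b}/(\sigma_a\sigma_b)$. Let $\tau$ be the permutation of $\{1,\dots,m\}$ with $\pi_{\tau(1)}\ge\dots\ge\pi_{\tau(m)}$ and $\tau(i)<\tau(j)$ whenever $i<j$ and $\pi_{\tau(i)}=\pi_{\tau(j)}$. For $1\le r\le m$ let $d_r$ be the multiplicity of $\pi_{\tau(r)}$ among $\pi_1,\dots,\pi_m$,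 and let $m_r=\max\{i:\pi_{\tau(i)}>\pi_{\tau(r)}\}$ (with $m_r=0$ if there is no such $i$). For $0\le s\le d$ let $$I_{s,d}=\bigl\{(t_{j,\ell})_{1\le j\le s,\,0\le \ell\le d}\in[0,1]^{s(d+1)}:\ t_{j,j-1}=0,\ t_{j,d-s+j}=1\ (1\le j\le s);\ t_{j,\ell-1}\le t_{j,\ell}\ (1\le j\le s,\,1\le\ell\le d);\ t_{j,\ell}\le t_{j-1,\ell-1}\ (2\le j\le s,\,1\le \ell\le d)\bigr\}.$$ Then for every $1\le r\le m-1$, $$\begin{aligned}V^r_\infty:={}&\sum_{i=1}^{m_r}\sigma_{\tau(i)}\tilde B^{\tau(i)}(1)+\max_{t\in I_{r-m_r,d_r}}\sum_{j=1}^{r-m_r}\ \sum_{\ell=j}^{m_r+d_r-r+j}\sigma_{\tau(m_r+\ell)}\bigl(\tilde B^{\tau(m_r+\ell)}(t_{j,\ell})-\tilde B^{\tau(m_r+\ell)}(t_{j,\ell-1})\bigr)\\ \stackrel{\mathcal L}{=}{}&\sum_{i=m_r+d_r+1}^{m}\sigma_{\tau(i)}\tilde B^{\tau(i)}(1)+\max_{u\in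 I_{m_r+d_r-r,d_r}}\sum_{j=1}^{m_r+d_r-r}\ \sum_{\ell=j}^{r-m_r+j}\sigma_{\tau(m_r+\ell)}\bigl(\tilde B^{\tau(m_r+\ell)}(u_{j,\ell})-\tilde B^{\tau(m_r+\ell)}(u_{j,\ell-1})\bigr),\end{aligned}$$ where empty sums are $0$ and the second maximum is $0$ if $m_r+d_r=r$. -/

import Mathlib

noncomputable section

open MeasureTheory ProbabilityTheory Filter Topology

/-! ### The Markov chain and its asymptotic covariance matrix -/

/-- `X` is a homogeneous Markov chain on the ordered alphabet `Fin m` with initial law `p` and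
transition matrix `P`, given through the probabilities of its finite paths. -/
structure IsMarkovChain {Ω : Type*} [MeasurableSpace Ω] {m : ℕ} (P : Matrix (Fin m) (Fin m) ℝ)
    (p : Fin m → ℝ) (X : ℕ → Ω → Fin m) (μ : Measure Ω) : Prop where
  measurable : ∀ n, Measurable (X n)
  path_prob : ∀ (n : ℕ) (x : ℕ → Fin m),
    μ.real {ω | ∀ i ≤ n, X i ω = x i} = p (x 0) * ∏ i ∈ Finset.range n, P (x i) (x (i + 1))

/-- Every state has period one: the only common divisor of the lengths of its possible
returns is `1`. -/
def IsAperiodic {m : ℕ} (P : Matrix (Fin m) (Fin m) ℝ) : Prop :=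
  ∀ (a : Fin m) (q : ℕ), (∀ n : ℕ, 1 ≤ n → 0 < (P ^ n) a a → q ∣ n) → q = 1

/-- `p` is a stationary distribution of the transition matrix `P`. -/
structure IsStationaryDistribution {m : ℕ} (P : Matrix (Fin m) (Fin m) ℝ) (p : Fin m → ℝ) : Prop where
  mem_stdSimplex : p ∈ stdSimplex ℝ (Fin m)
  vecMul_eq : Matrix.vecMul p P = p

/-- `T^a_k`: the number of `1 ≤ i ≤ k` with `X_i = a`, minus `p_a k`. -/
def centeredCount {Ω : Type*} {m : ℕ} (p : Fin m → ℝ) (X : ℕ → Ω → Fin m)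
    (a : Fin m) (k : ℕ) (ω : Ω) : ℝ :=
  ((Finset.Icc 1 k).filter fun i => X i ω = a).card - p a * k

/-- The asymptotic covariance matrix `Σ`, with entries `lim_k Cov(T^a_k, T^b_k) / k`. -/
def asymptoticCov {Ω : Type*} [MeasurableSpace Ω] {m : ℕ} (p : Fin m → ℝ)
    (X : ℕ → Ω → Fin m) (μ : Measure Ω) : Matrix (Fin m) (Fin m) ℝ :=
  Matrix.of fun a b => limUnder atTop fun k : ℕ =>
    cov[centeredCount p X a k, centeredCount p X b k; μ] / (k : ℝ)

/-- `σ_a = √Σ_{a,a}`. -/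
def stdDev {m : ℕ} (S : Matrix (Fin m) (Fin m) ℝ) (a : Fin m) : ℝ := √(S a a)

/-- The correlation matrix `Σ_{a,b} / (σ_a σ_b)`. -/
def correlation {m : ℕ} (S : Matrix (Fin m) (Fin m) ℝ) : Matrix (Fin m) (Fin m) ℝ :=
  Matrix.of fun a b => S a b / (stdDev S a * stdDev S b)

/-- `B = (B^1(t), …, B^m(t))`, `0 ≤ t ≤ 1`, is an `m`-dimensional Brownian motion with covariance
matrix `t C`: a centered Gaussian process with almost surely continuous paths and
`Cov(B^a(s), B^b(t)) = min(s, t) C_{a,b}` (so that `B(0) = 0` almost surely). -/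
structure IsBrownianMotionWithCov {Ω : Type*} [MeasurableSpace Ω] {m : ℕ}
    (C : Matrix (Fin m) (Fin m) ℝ) (B : unitInterval → Ω → Fin m → ℝ) (μ : Measure Ω) : Prop where
  gaussian : IsGaussianProcess B μ
  centered : ∀ t a, ∫ ω, B t ω a ∂μ = 0
  covariance : ∀ s t a b,
    cov[fun ω => B s ω a, fun ω => B t ω b; μ] = min (s : ℝ) (t : ℝ) * C a b
  continuous : ∀ᵐ ω ∂μ, Continuous fun t => B t ω

/-! ### Ranking the letters by stationary probability -/

/-- `τ` sorts the letters by decreasing probability, ties being broken by the order of the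
alphabet. -/
structure IsRanking {m : ℕ} (p : Fin m → ℝ) (τ : Equiv.Perm (Fin m)) : Prop where
  antitone : ∀ i j, i ≤ j → p (τ j) ≤ p (τ i)
  tie : ∀ i j, i < j → p (τ i) = p (τ j) → τ i < τ j

/-- `f_{τ(i)}` for a position `i ∈ {1, …, m}` (counted from one); `0` for other `i`, which are
never used. -/
def ranked {α : Type*} [Zero α] {m : ℕ} (τ : Equiv.Perm (Fin m)) (f : Fin m → α) (i : ℕ) : α :=
  if h : 1 ≤ i ∧ i ≤ m then f (τ ⟨i - 1, by omega⟩) else 0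

/-- `d_r`: the multiplicity of `p_{τ(r)}`. -/
def letterMultiplicity {m : ℕ} (p : Fin m → ℝ) (τ : Equiv.Perm (Fin m)) (r : ℕ) : ℕ :=
  (Finset.univ.filter fun a => p a = ranked τ p r).card

/-- `m_r`: the largest `i ∈ {1, …, m}` with `p_{τ(i)} > p_{τ(r)}`, and `0` if there is none. -/
def lastAbove {m : ℕ} (p : Fin m → ℝ) (τ : Equiv.Perm (Fin m)) (r : ℕ) : ℕ :=
  ((Finset.Icc 1 m).filter fun i => ranked τ p r < ranked τ p i).sup id

/-! ### The Brownian functionals -/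

/-- The index set `I_{s,d}` of arrays `t_{j,ℓ} ∈ [0,1]`, `1 ≤ j ≤ s`, `0 ≤ ℓ ≤ d`. Row `j` runs
through the letters in increasing order and occupies letter `ℓ` during `[t_{j,ℓ-1}, t_{j,ℓ}]`; the
last condition says that row `j` has left letter `ℓ` before row `j - 1` enters it, so that
the rows occupy different letters at each time. Entries outside the stated range are irrelevant. -/
def staircase (s d : ℕ) : Set (ℕ → ℕ → unitInterval) :=
  {t | (∀ j, 1 ≤ j → j ≤ s → t j (j - 1) = 0 ∧ t j (d - s + j) = 1) ∧
    (∀ j ℓ, 1 ≤ j → j ≤ s → 1 ≤ ℓ → ℓ ≤ d → t j (ℓ - 1) ≤ t j ℓ) ∧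
    (∀ j ℓ, 2 ≤ j → j ≤ s → 1 ≤ ℓ → ℓ ≤ d → t j ℓ ≤ t (j - 1) (ℓ - 1))}

/-- The maximum over `t ∈ I_{s,d}` of
`∑_{j=1}^{s} ∑_{ℓ=j}^{d-s+j} (x_ℓ(t_{j,ℓ}) - x_ℓ(t_{j,ℓ-1}))`, for paths `x_1, …, x_d` on `[0,1]`.
It is `0` for `s = 0`. -/
def staircaseMax (s d : ℕ) (x : ℕ → unitInterval → ℝ) : ℝ :=
  sSup ((fun t : ℕ → ℕ → unitInterval => ∑ j ∈ Finset.Icc 1 s, ∑ ℓ ∈ Finset.Icc j (d - s + j),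
    (x ℓ (t j ℓ) - x ℓ (t j (ℓ - 1)))) '' staircase s d)

/-- The paths `σ_{τ(i)} B^{τ(i)}`, `1 ≤ i ≤ m`. -/
def rankedPath {Ω : Type*} {m : ℕ} (sd : Fin m → ℝ) (τ : Equiv.Perm (Fin m))
    (B : unitInterval → Ω → Fin m → ℝ) (ω : Ω) : ℕ → unitInterval → ℝ :=
  ranked τ fun a t => sd a * B t ω a

/-- The limiting functional `V^r_∞`. -/
def limitFunctional {Ω : Type*} {m : ℕ} (p sd : Fin m → ℝ) (τ : Equiv.Perm (Fin m))
    (B : unitInterval → Ω → Fin m → ℝ) (r : ℕ) (ω : Ω) : ℝ :=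
  ∑ i ∈ Finset.Icc 1 (lastAbove p τ r), rankedPath sd τ B ω i 1 +
    staircaseMax (r - lastAbove p τ r) (letterMultiplicity p τ r)
      fun ℓ => rankedPath sd τ B ω (lastAbove p τ r + ℓ)

/-- The mirrored functional: letters of smaller probability, and the remaining
`m_r + d_r - r` rows on the letters of probability `p_{τ(r)}`. -/
def mirrorFunctional {Ω : Type*} {m : ℕ} (p sd : Fin m → ℝ) (τ : Equiv.Perm (Fin m))
    (B : unitInterval → Ω → Fin m → ℝ) (r : ℕ) (ω : Ω) : ℝ :=
  ∑ i ∈ Finset.Icc (lastAbove p τ r + letterMultiplicity p τ r + 1) m, rankedPath sd τ B ω i 1 +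
    staircaseMax (lastAbove p τ r + letterMultiplicity p τ r - r) (letterMultiplicity p τ r)
      fun ℓ => rankedPath sd τ B ω (lastAbove p τ r + ℓ)

end

open MeasureTheory ProbabilityTheory Filter Topology

/-! At each time the `s` rows of a staircase occupy `s` of the `d` tied letters. The `d - s` free
letters, read backwards in time, form a staircase again, and increments along the occupied letters
equal all increments minus those along the free ones. Reversing a path negates its increments, so
`staircaseMax_complement` holds path by path: the maximum with `s` rows is the total increment of
the `d` letters plus the maximum with `d - s` rows for the reversed paths.

The letter counts add up to `k`, so the rows of the asymptotic covariance matrix sum to zero and `∑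
σ_a B^a(1) = 0` almost surely. Thus the larger and tied letters together contribute minus what the
smaller ones do, which is what the smaller ones contribute after reversal. Hence almost surely
`V^r_∞` of `B` is the mirrored functional of the reversed process
(`limitFunctional_eq_mirrorFunctional_reverseProcess`).

The reversed process is a Brownian motion with the same covariance
(`IsBrownianMotionWithCov.reverse`), and the functional is measurable in countably many values of a
continuous path, so the laws agree. Since the covariance matrix is a `limUnder`, its limits must
also be shown to exist; this rests on the Poisson equation of the chain. -/

/-! ### Complementary staircases -/

/-- The path run backwards in time and started at `0`. -/
def reversePath (x : unitInterval → ℝ) (u : unitInterval) : ℝ := x (unitInterval.symm u) - x 1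

/-- The array of the letters that are left free by the `s` rows of `t`, run backwards in time. -/
def complementArray (s : ℕ) (t : ℕ → ℕ → unitInterval) (h ℓ : ℕ) : unitInterval :=
  -- When row `j` of `t` passes from `ℓ` to `ℓ + 1`, the letter `ℓ` becomes free. Below it lie `j -
  -- 1` occupied letters, so it is the free letter number `h = ℓ - j + 1`.
  if ℓ < h then 0 else if s + h ≤ ℓ then 1 else unitInterval.symm (t (ℓ - h + 1) ℓ)

theorem complementArray_of_lt {s : ℕ} {t : ℕ → ℕ → unitInterval} {h ℓ : ℕ} (hl : ℓ < h) :
    complementArray s t h ℓ = 0 := by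
  simp [complementArray, hl]

theorem complementArray_of_ge {s : ℕ} {t : ℕ → ℕ → unitInterval} {h ℓ : ℕ} (hl : s + h ≤ ℓ) :
    complementArray s t h ℓ = 1 := by
  simp [complementArray, hl, show ¬ ℓ < h by omega]

theorem complementArray_of_mem {s : ℕ} {t : ℕ → ℕ → unitInterval} {h ℓ : ℕ} (h1 : h ≤ ℓ)
    (h2 : ℓ < s + h) : complementArray s t h ℓ = unitInterval.symm (t (ℓ - h + 1) ℓ) := by
  simp [complementArray, show ¬ ℓ < h by omega, show ¬ s + h ≤ ℓ by omega]

/-- Complementation exchanges the two families of inequalities: separation of the rows of `t` gives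
monotonicity of the new rows, and monotonicity gives separation. -/
theorem complementArray_mem_staircase {s d : ℕ} (hs : s ≤ d) {t : ℕ → ℕ → unitInterval}
    (ht : t ∈ staircase s d) : complementArray s t ∈ staircase (d - s) d := by
  obtain ⟨-, hmono, hsep⟩ := ht
  refine ⟨fun j h1 h2 => ⟨complementArray_of_lt (by omega), complementArray_of_ge (by omega)⟩,
    fun j ℓ h1 h2 h3 h4 => ?_, fun j ℓ h1 h2 h3 h4 => ?_⟩
  · rcases lt_or_ge (ℓ - 1) j with h | h
    · rw [complementArray_of_lt h]
      exact bot_le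
    rcases lt_or_ge ℓ (s + j) with h' | h'
    · rw [complementArray_of_mem h (by omega), complementArray_of_mem (by omega) h',
        unitInterval.symm_le_symm]
      have := hsep (ℓ - j + 1) ℓ (by omega) (by omega) h3 h4
      rwa [show ℓ - 1 - j + 1 = ℓ - j + 1 - 1 by omega]
    · rw [complementArray_of_ge h']
      exact le_top
  · rcases lt_or_ge ℓ j with h | h
    · rw [complementArray_of_lt h]
      exact bot_le
    rcases lt_or_ge ℓ (s + j) with h' | h'
    · rw [complementArray_of_mem h h', complementArray_of_mem (by omega) (by omega),
        unitInterval.symm_le_symm, show ℓ - 1 - (j - 1) + 1 = ℓ - j + 1 by omega]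
      exact hmono _ ℓ (by omega) (by omega) h3 h4
    · rw [complementArray_of_ge (ℓ := ℓ - 1) (by omega)]
      exact le_top

theorem staircase_nonempty {s d : ℕ} (hs : s ≤ d) : (staircase s d).Nonempty := by
  -- Row `j` stays on letter `d - s + j` during all of `[0,1]`.
  refine ⟨fun j ℓ => if d - s + j ≤ ℓ then 1 else 0, fun j h1 h2 => ⟨?_, ?_⟩,
    fun j ℓ h1 h2 h3 h4 => ?_, fun j ℓ h1 h2 h3 h4 => ?_⟩
  · simp only [ite_eq_right_iff]
    omega
  · simp
  · dsimp only
    split_ifs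
    · exact le_rfl
    · omega
    · exact bot_le
    · exact le_rfl
  · refine le_of_eq (if_congr ?_ rfl rfl)
    omega

/-- The quantity that is maximized in `staircaseMax`. -/
def staircaseSum (s d : ℕ) (x : ℕ → unitInterval → ℝ) (t : ℕ → ℕ → unitInterval) : ℝ :=
  ∑ j ∈ Finset.Icc 1 s, ∑ ℓ ∈ Finset.Icc j (d - s + j), (x ℓ (t j ℓ) - x ℓ (t j (ℓ - 1)))

theorem staircaseMax_eq_sSup (s d : ℕ) (x : ℕ → unitInterval → ℝ) :
    staircaseMax s d x = sSup (staircaseSum s d x '' staircase s d) := rfl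

theorem sum_Icc_eq_sum_range_add (a n : ℕ) (f : ℕ → ℝ) :
    ∑ i ∈ Finset.Icc a (n + a), f i = ∑ k ∈ Finset.range (n + 1), f (a + k) := by
  have : Finset.Icc a (n + a) = Finset.Ico a (n + a + 1) := by
    ext i
    simp only [Finset.mem_Icc, Finset.mem_Ico]
    omega
  rw [this, Finset.sum_Ico_eq_sum_range]
  congr 2
  omega

theorem sum_Icc_one_eq_sum_range (n : ℕ) (f : ℕ → ℝ) :
    ∑ i ∈ Finset.Icc 1 n, f i = ∑ k ∈ Finset.range n, f (k + 1) := by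
  have : Finset.Icc 1 n = Finset.Ico 1 (n + 1) := by
    ext i
    simp only [Finset.mem_Icc, Finset.mem_Ico]
    omega
  rw [this, Finset.sum_Ico_eq_sum_range]
  simp [add_comm]

/-- Summation by parts: terms are grouped by jump time, where a row leaves one letter and enters the
next, instead of by letter. -/
theorem sum_Icc_sub_eq (a n : ℕ) (x : ℕ → unitInterval → ℝ) (t : ℕ → unitInterval) :
    ∑ ℓ ∈ Finset.Icc (a + 1) (n + (a + 1)), (x ℓ (t ℓ) - x ℓ (t (ℓ - 1))) =
      ∑ k ∈ Finset.range n, (x (a + k + 1) (t (a + k + 1)) - x (a + k + 2) (t (a + k + 1))) +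
        (x (n + a + 1) (t (n + a + 1)) - x (a + 1) (t a)) := by
  rw [sum_Icc_eq_sum_range_add, Finset.sum_sub_distrib, Finset.sum_range_succ,
    Finset.sum_range_succ' (fun k => x (a + 1 + k) (t (a + 1 + k - 1))), Finset.sum_sub_distrib]
  have h1 : ∀ k, a + 1 + k = a + k + 1 := fun k => by omega
  have h2 : ∀ k, a + k + 1 + 1 = a + k + 2 := fun k => by omega
  simp only [h1, ← add_assoc, h2, Nat.add_sub_cancel, add_zero, add_comm n a]
  have h3 : ∀ k, a + k + 2 - 1 = a + k + 1 := fun k => by omega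
  simp only [h3]
  ring

/-- The sum over a staircase in terms of the jump times of its rows. -/
theorem staircaseSum_eq {s d : ℕ} (x : ℕ → unitInterval → ℝ)
    {t : ℕ → ℕ → unitInterval} (ht : t ∈ staircase s d) :
    staircaseSum s d x t =
      ∑ j ∈ Finset.range s, ∑ k ∈ Finset.range (d - s),
        (x (j + k + 1) (t (j + 1) (j + k + 1)) - x (j + k + 2) (t (j + 1) (j + k + 1))) +
      ∑ j ∈ Finset.range s, (x (d - s + j + 1) 1 - x (j + 1) 0) := by
  rw [staircaseSum, sum_Icc_one_eq_sum_range, ← Finset.sum_add_distrib]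
  refine Finset.sum_congr rfl fun j hj => ?_
  rw [Finset.mem_range] at hj
  obtain ⟨h0, h1⟩ := ht.1 (j + 1) (by omega) (by omega)
  rw [sum_Icc_sub_eq, add_assoc (d - s) j 1, h1]
  rw [Nat.add_sub_cancel] at h0
  rw [h0]

theorem staircaseSum_complementArray {s d : ℕ} (hs : s ≤ d) (x : ℕ → unitInterval → ℝ)
    {t : ℕ → ℕ → unitInterval} (ht : t ∈ staircase s d) :
    staircaseSum s d x t = ∑ ℓ ∈ Finset.Icc 1 d, (x ℓ 1 - x ℓ 0) +
      staircaseSum (d - s) d (fun ℓ => reversePath (x ℓ)) (complementArray s t) := by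
  rw [staircaseSum_eq x ht, staircaseSum_eq _ (complementArray_mem_staircase hs ht),
    sum_Icc_one_eq_sum_range, Nat.sub_sub_self hs, Finset.sum_comm]
  -- Both arrays have the same jumps, with row and step indices exchanged; the jump terms differ
  -- only by values at time `1`, which telescope in `h3`.
  have h1 : ∀ k ∈ Finset.range (d - s), ∀ j ∈ Finset.range s,
      reversePath (x (k + j + 1)) (complementArray s t (k + 1) (k + j + 1)) -
        reversePath (x (k + j + 2)) (complementArray s t (k + 1) (k + j + 1)) =
      (x (j + k + 1) (t (j + 1) (j + k + 1)) - x (j + k + 2) (t (j + 1) (j + k + 1))) +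
        (x (k + j + 2) 1 - x (k + j + 1) 1) := by
    intro k hk j hj
    rw [Finset.mem_range] at hk hj
    rw [complementArray_of_mem (by omega) (by omega), reversePath, reversePath,
      unitInterval.symm_symm, show k + j + 1 - (k + 1) + 1 = j + 1 by omega, add_comm k j]
    ring
  have h2 : ∀ k ∈ Finset.range (d - s), reversePath (x (s + k + 1)) 1 - reversePath (x (k + 1)) 0 =
      x (s + k + 1) 0 - x (s + k + 1) 1 := by
    intro k _
    simp [reversePath]
  have h3 : ∀ k ∈ Finset.range (d - s),
      ∑ j ∈ Finset.range s, (x (k + j + 2) 1 - x (k + j + 1) 1) = x (s + k + 1) 1 - x (k + 1) 1 := by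
    intro k _
    have := Finset.sum_range_sub (fun j => x (k + j + 1) 1) s
    simp only [add_zero, ← add_assoc] at this
    rw [add_comm s k, ← this]
  rw [Finset.sum_congr rfl fun k hk => Finset.sum_congr rfl (h1 k hk), Finset.sum_congr rfl h2]
  simp only [Finset.sum_add_distrib]
  rw [Finset.sum_congr rfl h3]
  -- At time `1` the rows of `t` sit on the last `s` letters; at time `0`, treated in `h5`, on the
  -- first `s`.
  have h4 : ∑ k ∈ Finset.range d, x (k + 1) 1 = ∑ k ∈ Finset.range (d - s), x (k + 1) 1 +
      ∑ j ∈ Finset.range s, x (d - s + j + 1) 1 := by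
    rw [← Finset.sum_range_add (fun k => x (k + 1) 1), Nat.sub_add_cancel hs]
  have h5 : ∑ k ∈ Finset.range d, x (k + 1) 0 = ∑ j ∈ Finset.range s, x (j + 1) 0 +
      ∑ k ∈ Finset.range (d - s), x (s + k + 1) 0 := by
    rw [← Finset.sum_range_add (fun k => x (k + 1) 0), Nat.add_sub_cancel' hs]
  simp only [Finset.sum_sub_distrib] at *
  linarith

theorem continuous_staircaseSum (s d : ℕ) {x : ℕ → unitInterval → ℝ} (hx : ∀ ℓ, Continuous (x ℓ)) :
    Continuous (staircaseSum s d x) := by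
  unfold staircaseSum
  fun_prop

/-- The space of all arrays is a product of compact intervals, so a continuous function on it is
bounded. -/
theorem bddAbove_staircaseSum (s d : ℕ) {x : ℕ → unitInterval → ℝ} (hx : ∀ ℓ, Continuous (x ℓ)) :
    BddAbove (Set.range (staircaseSum s d x)) :=
  (isCompact_range (continuous_staircaseSum s d hx)).bddAbove

theorem continuous_reversePath {x : unitInterval → ℝ} (hx : Continuous x) :
    Continuous (reversePath x) := by
  unfold reversePath
  fun_prop

theorem staircaseMax_le_complement {s d : ℕ} (hs : s ≤ d) {x : ℕ → unitInterval → ℝ}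
    (hx : ∀ ℓ, Continuous (x ℓ)) :
    staircaseMax s d x ≤ ∑ ℓ ∈ Finset.Icc 1 d, (x ℓ 1 - x ℓ 0) +
      staircaseMax (d - s) d (fun ℓ => reversePath (x ℓ)) := by
  rw [staircaseMax_eq_sSup, staircaseMax_eq_sSup]
  refine csSup_le ((staircase_nonempty hs).image _) ?_
  rintro _ ⟨t, ht, rfl⟩
  rw [staircaseSum_complementArray hs x ht]
  gcongr
  exact le_csSup ((bddAbove_staircaseSum _ _ fun ℓ => continuous_reversePath (hx ℓ)).mono
    (Set.image_subset_range _ _)) ⟨_, complementArray_mem_staircase hs ht, rfl⟩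

/-- Reversing twice changes a path by a constant only, which cancels in increments. -/
theorem staircaseMax_reversePath_reversePath (s d : ℕ) (x : ℕ → unitInterval → ℝ) :
    staircaseMax s d (fun ℓ => reversePath (reversePath (x ℓ))) = staircaseMax s d x := by
  simp [staircaseMax, reversePath]

/-- Complementing the rows of a staircase exchanges `s` and `d - s` and reverses time. -/
theorem staircaseMax_complement {s d : ℕ} (hs : s ≤ d) {x : ℕ → unitInterval → ℝ}
    (hx : ∀ ℓ, Continuous (x ℓ)) :
    staircaseMax s d x = ∑ ℓ ∈ Finset.Icc 1 d, (x ℓ 1 - x ℓ 0) +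
      staircaseMax (d - s) d (fun ℓ => reversePath (x ℓ)) := by
  refine le_antisymm (staircaseMax_le_complement hs hx) ?_
  -- The same inequality for the reversed paths and `d - s` rows is the missing bound.
  have := staircaseMax_le_complement (Nat.sub_le d s) fun ℓ => continuous_reversePath (hx ℓ)
  rw [Nat.sub_sub_self hs, staircaseMax_reversePath_reversePath] at this
  have h : ∑ ℓ ∈ Finset.Icc 1 d, (reversePath (x ℓ) 1 - reversePath (x ℓ) 0) =
      -∑ ℓ ∈ Finset.Icc 1 d, (x ℓ 1 - x ℓ 0) := by
    rw [← Finset.sum_neg_distrib]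
    exact Finset.sum_congr rfl fun ℓ _ => by simp [reversePath]
  linarith

/-- The supremum of a bounded continuous function over a separable set is attained along a dense
sequence. -/
theorem sSup_image_eq_iSup_denseSeq {α : Type*} [TopologicalSpace α] (S : Set α)
    [TopologicalSpace.SeparableSpace S] [Nonempty S] {F : α → ℝ} (hF : Continuous F)
    (hb : BddAbove (Set.range F)) :
    sSup (F '' S) = ⨆ n, F (TopologicalSpace.denseSeq S n) := by
  have hb' : BddAbove (Set.range fun n => F (TopologicalSpace.denseSeq S n)) :=
    hb.mono (Set.range_subset_iff.2 fun n => Set.mem_range_self _)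
  refine le_antisymm (csSup_le ((Set.nonempty_coe_sort.1 ‹_›).image _) ?_) (ciSup_le fun n =>
    le_csSup (hb.mono (Set.image_subset_range _ _)) ⟨_, Subtype.coe_prop _, rfl⟩)
  rintro _ ⟨t, ht, rfl⟩
  have hc : IsClosed {u : S | F u ≤ ⨆ n, F (TopologicalSpace.denseSeq S n)} :=
    isClosed_le (hF.comp continuous_subtype_val) continuous_const
  have hd := (TopologicalSpace.denseRange_denseSeq S).closure_eq
  have : closure (Set.range (TopologicalSpace.denseSeq S)) ⊆
      {u : S | F u ≤ ⨆ n, F (TopologicalSpace.denseSeq S n)} :=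
    hc.closure_subset_iff.2 (Set.range_subset_iff.2 fun n => le_ciSup hb' n)
  rw [hd] at this
  exact this (Set.mem_univ ⟨t, ht⟩)

/-! ### The Poisson equation of an irreducible chain -/

section Poisson

open Matrix

variable {m : ℕ} {P : Matrix (Fin m) (Fin m) ℝ} {p : Fin m → ℝ}

theorem pow_mulVec_eq_of_mulVec_eq {g : Fin m → ℝ} (hg : P *ᵥ g = g) (n : ℕ) :
    P ^ n *ᵥ g = g := by
  induction n with
  | zero => simp
  | succ n ih => rw [pow_succ, ← mulVec_mulVec, hg, ih]

/-- Harmonic functions of an irreducible chain are constant. -/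
theorem eq_of_mulVec_eq (hP : P ∈ rowStochastic ℝ (Fin m)) (hirr : P.IsIrreducible)
    {g : Fin m → ℝ} (hg : P *ᵥ g = g) (b c : Fin m) : g b = g c := by
  have : Nonempty (Fin m) := ⟨b⟩
  obtain ⟨a, ha⟩ := Finite.exists_max g
  suffices h : ∀ b, g b = g a by rw [h b, h c]
  intro b
  obtain ⟨k, -, hk⟩ := (isIrreducible_iff_exists_pow_pos hP.1).1 hirr a b
  have hPk : P ^ k ∈ rowStochastic ℝ (Fin m) := pow_mem hP k
  -- Maximum principle: the nonnegative gaps below the maximum average to zero, so the gap at `b`,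
  -- which has positive weight, vanishes.
  have h1 : ∑ c, (P ^ k) a c * (g a - g c) = 0 := by
    have := congrFun (pow_mulVec_eq_of_mulVec_eq hg k) a
    simp only [mulVec, dotProduct] at this
    simp only [mul_sub, Finset.sum_sub_distrib]
    rw [this, ← Finset.sum_mul, sum_row_of_mem_rowStochastic hPk, one_mul, sub_self]
  have h2 := (Finset.sum_eq_zero_iff_of_nonneg fun c _ =>
    mul_nonneg (hPk.1 a c) (sub_nonneg.2 (ha c))).1 h1 b (Finset.mem_univ b)
  rcases mul_eq_zero.1 h2 with h | h
  · exact absurd h hk.ne'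
  · linarith

/-- The Poisson equation `g - P g = f` is solvable for centered `f`. -/
theorem exists_sub_mulVec_eq (hP : P ∈ rowStochastic ℝ (Fin m)) (hirr : P.IsIrreducible)
    (hp : IsStationaryDistribution P p) {f : Fin m → ℝ} (hf : p ⬝ᵥ f = 0) :
    ∃ g : Fin m → ℝ, g - P *ᵥ g = f := by
  have hp1 : p ⬝ᵥ (1 : Fin m → ℝ) = 1 := by simpa [dotProduct] using hp.mem_stdSimplex.2
  have hpP : ∀ g : Fin m → ℝ, p ⬝ᵥ (P *ᵥ g) = p ⬝ᵥ g := fun g => by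
    rw [dotProduct_mulVec, hp.vecMul_eq]
  -- The rank-one term removes the kernel of `1 - P`, the constants. Hence `A` is bijective, and the
  -- term is zero on the preimage of a centered `f` because `p ⬝ᵥ A g = p ⬝ᵥ g`.
  let A : (Fin m → ℝ) →ₗ[ℝ] (Fin m → ℝ) :=
    { toFun g := g - P *ᵥ g + (p ⬝ᵥ g) • (1 : Fin m → ℝ)
      map_add' g h := by simp only [mulVec_add, dotProduct_add]; module
      map_smul' c g := by
        simp only [mulVec_smul, dotProduct_smul, RingHom.id_apply, smul_eq_mul]; module }
  have hA : ∀ g, A g = g - P *ᵥ g + (p ⬝ᵥ g) • (1 : Fin m → ℝ) := fun g => rfl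
  have hpA : ∀ g, p ⬝ᵥ A g = p ⬝ᵥ g := fun g => by
    rw [hA, dotProduct_add, dotProduct_sub, hpP, dotProduct_smul, hp1]
    simp
  have hinj : Function.Injective A := by
    rw [← LinearMap.ker_eq_bot, LinearMap.ker_eq_bot']
    intro g hg
    have h0 : p ⬝ᵥ g = 0 := by rw [← hpA, hg, dotProduct_zero]
    have h1 : P *ᵥ g = g := by
      rw [hA, h0, zero_smul, add_zero, sub_eq_zero] at hg
      exact hg.symm
    ext b
    have h2 : g = g b • (1 : Fin m → ℝ) := by
      ext c
      simpa using eq_of_mulVec_eq hP hirr h1 c b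
    rw [h2, dotProduct_smul, hp1] at h0
    simpa using h0
  obtain ⟨g, hg⟩ := LinearMap.injective_iff_surjective.1 hinj f
  refine ⟨g, ?_⟩
  have h0 : p ⬝ᵥ g = 0 := by rw [← hpA, hg, hf]
  rw [hA, h0, zero_smul, add_zero] at hg
  exact hg

theorem abs_pow_mulVec_le (hP : P ∈ rowStochastic ℝ (Fin m)) (g : Fin m → ℝ) (n : ℕ) (b : Fin m) :
    |(P ^ n *ᵥ g) b| ≤ ∑ c, |g c| := by
  have hPn : P ^ n ∈ rowStochastic ℝ (Fin m) := pow_mem hP n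
  rw [mulVec, dotProduct]
  refine (Finset.abs_sum_le_sum_abs _ _).trans (Finset.sum_le_sum fun c _ => ?_)
  rw [abs_mul, abs_of_nonneg (hPn.1 b c)]
  exact mul_le_of_le_one_left (abs_nonneg _) (le_one_of_mem_rowStochastic hPn)

/-- Telescoping: once `f = g - P g`, the partial sums of `P ^ i f` stay bounded. -/
theorem sum_pow_mulVec_sub (g : Fin m → ℝ) (n : ℕ) (b : Fin m) :
    ∑ i ∈ Finset.range n, (P ^ i *ᵥ (g - P *ᵥ g)) b = g b - (P ^ n *ᵥ g) b := by
  have h : ∀ i, (P ^ i *ᵥ (g - P *ᵥ g)) b = (P ^ i *ᵥ g) b - (P ^ (i + 1) *ᵥ g) b := fun i => by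
    rw [mulVec_sub, mulVec_mulVec, ← pow_succ, Pi.sub_apply]
  simp only [h]
  rw [Finset.sum_range_sub']
  simp

/-- The Cesàro means of `P ^ n f` converge to the stationary mean of `f`. -/
theorem tendsto_cesaro_pow_mulVec (hP : P ∈ rowStochastic ℝ (Fin m)) (hirr : P.IsIrreducible)
    (hp : IsStationaryDistribution P p) (f : Fin m → ℝ) (b : Fin m) :
    Tendsto (fun n : ℕ => (n : ℝ)⁻¹ * ∑ i ∈ Finset.range n, (P ^ i *ᵥ f) b) atTop
      (𝓝 (p ⬝ᵥ f)) := by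
  have hp1 : p ⬝ᵥ (1 : Fin m → ℝ) = 1 := by simpa [dotProduct] using hp.mem_stdSimplex.2
  obtain ⟨g, hg⟩ := exists_sub_mulVec_eq hP hirr hp (f := f - (p ⬝ᵥ f) • (1 : Fin m → ℝ)) (by
    rw [dotProduct_sub, dotProduct_smul, hp1]
    simp)
  have h1 : ∀ i, (P ^ i *ᵥ f) b = (P ^ i *ᵥ (g - P *ᵥ g)) b + p ⬝ᵥ f := fun i => by
    have : P ^ i *ᵥ (1 : Fin m → ℝ) = 1 := (pow_mem hP i : P ^ i ∈ rowStochastic ℝ (Fin m)).2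
    rw [hg, mulVec_sub, mulVec_smul, this]
    simp
  have h2 : Tendsto (fun n : ℕ => (n : ℝ)⁻¹ * (g b - (P ^ n *ᵥ g) b)) atTop (𝓝 0) := by
    refine (tendsto_inv_atTop_nhds_zero_nat (𝕜 := ℝ)).zero_mul_isBoundedUnder_le ?_
    refine isBoundedUnder_of ⟨|g b| + ∑ c, |g c|, fun n => ?_⟩
    exact (norm_sub_le _ _).trans (by gcongr <;> simp [abs_pow_mulVec_le hP])
  have h3 : Tendsto (fun n : ℕ => (n : ℝ)⁻¹ * (g b - (P ^ n *ᵥ g) b) + p ⬝ᵥ f) atTop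
      (𝓝 (p ⬝ᵥ f)) := by simpa using h2.add_const (p ⬝ᵥ f)
  refine h3.congr' ?_
  filter_upwards [eventually_gt_atTop 0] with n hn
  have hn' : (n : ℝ) ≠ 0 := by positivity
  simp only [h1, Finset.sum_add_distrib, sum_pow_mulVec_sub, Finset.sum_const, Finset.card_range,
    nsmul_eq_mul]
  field_simp

/-- For centered `f`, the partial sums of `P ^ n f` converge in the sense of Cesàro. -/
theorem exists_tendsto_cesaro_sum_pow_mulVec (hP : P ∈ rowStochastic ℝ (Fin m))
    (hirr : P.IsIrreducible) (hp : IsStationaryDistribution P p) {f : Fin m → ℝ}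
    (hf : p ⬝ᵥ f = 0) (b : Fin m) :
    ∃ l, Tendsto (fun n : ℕ => (n : ℝ)⁻¹ * ∑ i ∈ Finset.range n,
      ∑ k ∈ Finset.range i, (P ^ k *ᵥ f) b) atTop (𝓝 l) := by
  obtain ⟨g, rfl⟩ := exists_sub_mulVec_eq hP hirr hp hf
  refine ⟨g b - p ⬝ᵥ g, ?_⟩
  refine ((tendsto_cesaro_pow_mulVec hP hirr hp g b).const_sub (g b)).congr' ?_
  filter_upwards [eventually_gt_atTop 0] with n hn
  have hn' : (n : ℝ) ≠ 0 := by positivity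
  simp only [sum_pow_mulVec_sub, Finset.sum_sub_distrib, Finset.sum_const, Finset.card_range,
    nsmul_eq_mul]
  field_simp

end Poisson

/-! ### Two-time laws of a stationary chain -/

section Chain

/-- The quadratic polynomial `c ↦ Var[U + c V]` is nonnegative, so its discriminant is not positive.
-/
theorem covariance_sq_le_variance_mul_variance {Ω : Type*} [MeasurableSpace Ω] {μ : Measure Ω}
    [IsProbabilityMeasure μ] {U V : Ω → ℝ} (hU : MemLp U 2 μ) (hV : MemLp V 2 μ) :
    cov[U, V; μ] ^ 2 ≤ Var[U; μ] * Var[V; μ] := by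
  have h := discrim_le_zero (a := Var[V; μ]) (b := 2 * cov[U, V; μ]) (c := Var[U; μ]) fun c => by
    have h1 := variance_nonneg (U + c • V) μ
    rw [variance_add hU (hV.const_smul c), variance_smul, covariance_smul_right] at h1
    linarith
  rw [discrim] at h
  linarith

variable {Ω : Type*} {m : ℕ} {P : Matrix (Fin m) (Fin m) ℝ} {p : Fin m → ℝ} {X : ℕ → Ω → Fin m}

/-- The indicator of `X_i = a`. -/
noncomputable def letterIndicator (X : ℕ → Ω → Fin m) (a : Fin m) (i : ℕ) : Ω → ℝ :=
  {ω | X i ω = a}.indicator 1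

theorem centeredCount_eq (p : Fin m → ℝ) (X : ℕ → Ω → Fin m) (a : Fin m) (k : ℕ) :
    centeredCount p X a k =
      fun ω => (∑ i ∈ Finset.Icc 1 k, letterIndicator X a i) ω - p a * k := by
  ext ω
  simp [centeredCount, letterIndicator, Set.indicator_apply, Finset.sum_apply]

/-- This deterministic relation is the source of the degeneracy of the limiting covariance. -/
theorem sum_centeredCount (hp : IsStationaryDistribution P p) (k : ℕ) :
    ∑ a, centeredCount p X a k = 0 := by
  ext ω
  have h1 : ∑ a, (((Finset.Icc 1 k).filter fun i => X i ω = a).card : ℝ) = k := by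
    rw [← Nat.cast_sum, Finset.sum_card_fiberwise_eq_card_filter]
    simp
  simp [centeredCount, Finset.sum_apply, ← Finset.sum_mul, hp.mem_stdSimplex.2, h1]

variable [MeasurableSpace Ω] {μ : Measure Ω}

theorem IsMarkovChain.measurableSet_eq (hX : IsMarkovChain P p X μ) (a : Fin m) (i : ℕ) :
    MeasurableSet {ω | X i ω = a} :=
  hX.measurable i (measurableSet_singleton a)

variable [IsProbabilityMeasure μ]

/-- The Markov property for events that depend on the first `n + 1` letters. -/
theorem IsMarkovChain.measureReal_step (hX : IsMarkovChain P p X μ) (n : ℕ)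
    (S : Finset (Fin (n + 1) → Fin m)) (b c : Fin m) (hS : ∀ x ∈ S, x (Fin.last n) = b) :
    μ.real {ω | (fun i : Fin (n + 1) => X i ω) ∈ S ∧ X (n + 1) ω = c} =
      μ.real {ω | (fun i : Fin (n + 1) => X i ω) ∈ S} * P b c := by
  have hm : Measurable fun ω => (fun i : Fin (n + 1) => X i ω) :=
    measurable_pi_lambda _ fun i => hX.measurable i
  -- `path_prob` takes infinite sequences but only reads an initial segment; padding with `c` lets
  -- one sequence serve for both `n` and `n + 1`.
  let extend (x : Fin (n + 1) → Fin m) (i : ℕ) : Fin m := if h : i < n + 1 then x ⟨i, h⟩ else c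
  have hlt : ∀ x i (h : i < n + 1), extend x i = x ⟨i, h⟩ := fun x i h => dif_pos h
  have hge : ∀ x, extend x (n + 1) = c := fun x => dif_neg (lt_irrefl _)
  have h1 : ∀ x, {ω | ∀ i ≤ n, X i ω = extend x i} =
      (fun ω => (fun i : Fin (n + 1) => X i ω)) ⁻¹' {x} := by
    intro x
    ext ω
    simp only [Set.mem_ofPred_eq, Set.mem_preimage, Set.mem_singleton_iff, funext_iff]
    refine ⟨fun h i => by rw [h i (by omega), hlt x i i.2], fun h i hi => ?_⟩
    rw [hlt x i (by omega)]
    exact h ⟨i, by omega⟩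
  have h2 : ∀ x, {ω | ∀ i ≤ n + 1, X i ω = extend x i} =
      (fun ω => ((fun i : Fin (n + 1) => X i ω), X (n + 1) ω)) ⁻¹' {(x, c)} := by
    intro x
    ext ω
    have := Set.ext_iff.1 (h1 x) ω
    simp only [Set.mem_ofPred_eq, Set.mem_preimage, Set.mem_singleton_iff] at this
    simp only [Set.mem_ofPred_eq, Set.mem_preimage, Set.mem_singleton_iff, Prod.mk.injEq, ← this]
    refine ⟨fun h => ⟨fun i hi => h i (by omega), by rw [h _ le_rfl, hge]⟩, fun h i hi => ?_⟩
    rcases Nat.le_succ_iff.1 hi with hi | rfl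
    · exact h.1 i hi
    · rw [h.2, hge]
  have h3 : {ω | (fun i : Fin (n + 1) => X i ω) ∈ S ∧ X (n + 1) ω = c} =
      (fun ω => ((fun i : Fin (n + 1) => X i ω), X (n + 1) ω)) ⁻¹' (S ×ˢ {c} : Finset _) := by
    ext ω
    simp [eq_comm]
  have h4 : {ω | (fun i : Fin (n + 1) => X i ω) ∈ S} =
      (fun ω => (fun i : Fin (n + 1) => X i ω)) ⁻¹' (S : Set _) := rfl
  rw [h3, h4, ← sum_measureReal_preimage_singleton _ fun y _ =>
      (hm.prodMk (hX.measurable (n + 1))) (measurableSet_singleton y),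
    ← sum_measureReal_preimage_singleton _ fun y _ => hm (measurableSet_singleton y),
    Finset.sum_product, Finset.sum_mul]
  refine Finset.sum_congr rfl fun x hx => ?_
  rw [Finset.sum_singleton, ← h1, ← h2, hX.path_prob, hX.path_prob, Finset.prod_range_succ, hge,
    hlt x n (by omega), ← hS x hx, mul_assoc]
  rfl

theorem IsMarkovChain.measureReal_eq (hX : IsMarkovChain P p X μ)
    (hp : IsStationaryDistribution P p) (n : ℕ) (a : Fin m) : μ.real {ω | X n ω = a} = p a := by
  induction n generalizing a with
  | zero => simpa using hX.path_prob 0 fun _ => a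
  | succ n ih =>
    have h1 : ∀ b, μ.real ({ω | X n ω = b ∧ X (n + 1) ω = a}) = p b * P b a := by
      intro b
      have := hX.measureReal_step n (Finset.univ.filter fun x => x (Fin.last n) = b) b a (by simp)
      simpa [ih] using this
    have h2 : {ω | X (n + 1) ω = a} = (fun ω => (X n ω, X (n + 1) ω)) ⁻¹'
        (Finset.univ ×ˢ {a} : Finset (Fin m × Fin m)) := by
      ext ω
      simp [eq_comm]
    rw [h2, ← sum_measureReal_preimage_singleton _ fun y _ =>
      ((hX.measurable n).prodMk (hX.measurable (n + 1))) (measurableSet_singleton y),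
      Finset.sum_product]
    have h3 := congrFun hp.vecMul_eq a
    simp only [Matrix.vecMul, dotProduct] at h3
    rw [← h3]
    refine Finset.sum_congr rfl fun b _ => ?_
    rw [Finset.sum_singleton, ← h1]
    congr 1
    ext ω
    simp

theorem IsMarkovChain.measureReal_pair (hX : IsMarkovChain P p X μ)
    (hp : IsStationaryDistribution P p) (i n : ℕ) (a b : Fin m) :
    μ.real {ω | X i ω = a ∧ X (i + n) ω = b} = p a * (P ^ n) a b := by
  induction n generalizing b with
  | zero =>
    rcases eq_or_ne a b with rfl | h
    · simpa using hX.measureReal_eq hp i a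
    · have : {ω | X i ω = a ∧ X (i + 0) ω = b} = ∅ := by
        ext ω
        simp only [add_zero, Set.mem_ofPred_eq, Set.mem_empty_iff_false, iff_false, not_and]
        rintro rfl
        exact h
      rw [this]
      simp [h]
  | succ n ih =>
    have h1 : ∀ c, μ.real ({ω | (X i ω = a ∧ X (i + n) ω = c) ∧ X (i + n + 1) ω = b}) =
        p a * (P ^ n) a c * P c b := by
      intro c
      -- The Markov property at time `i + n`, with the letter at time `i` kept as part of the past;
      -- summing over `c` then gives the matrix product.
      have := hX.measureReal_step (i + n)
        (Finset.univ.filter fun x => x ⟨i, by omega⟩ = a ∧ x (Fin.last (i + n)) = c) c b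
        (by simp)
      simpa [ih] using this
    have h2 : {ω | X i ω = a ∧ X (i + (n + 1)) ω = b} =
        (fun ω => (X (i + n) ω, X i ω, X (i + n + 1) ω)) ⁻¹'
        (Finset.univ ×ˢ {(a, b)} : Finset (Fin m × Fin m × Fin m)) := by
      ext ω
      simp [add_assoc, eq_comm]
    rw [h2, ← sum_measureReal_preimage_singleton _ fun y _ =>
      ((hX.measurable (i + n)).prodMk ((hX.measurable i).prodMk (hX.measurable (i + n + 1))))
        (measurableSet_singleton y), Finset.sum_product, pow_succ, Matrix.mul_apply,
      Finset.mul_sum]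
    refine Finset.sum_congr rfl fun c _ => ?_
    rw [Finset.sum_singleton, ← mul_assoc, ← h1]
    congr 1
    ext ω
    simp only [Set.mem_preimage, Set.mem_singleton_iff, Prod.mk.injEq, Set.mem_ofPred_eq]
    tauto

theorem IsMarkovChain.memLp_letterIndicator (hX : IsMarkovChain P p X μ) (a : Fin m) (i : ℕ) :
    MemLp (letterIndicator X a i) 2 μ :=
  (memLp_const (1 : ℝ)).indicator (hX.measurableSet_eq a i)

theorem IsMarkovChain.covariance_letterIndicator (hX : IsMarkovChain P p X μ)
    (hp : IsStationaryDistribution P p) (i n : ℕ) (a b : Fin m) :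
    cov[letterIndicator X a i, letterIndicator X b (i + n); μ] =
      p a * (P ^ n) a b - p a * p b := by
  rw [covariance_eq_sub (hX.memLp_letterIndicator a i) (hX.memLp_letterIndicator b (i + n))]
  have h : letterIndicator X a i * letterIndicator X b (i + n) =
      {ω | X i ω = a ∧ X (i + n) ω = b}.indicator 1 := by
    ext ω
    by_cases h1 : X i ω = a <;> by_cases h2 : X (i + n) ω = b <;> simp [letterIndicator, h1, h2]
  have hm : MeasurableSet {ω | X i ω = a ∧ X (i + n) ω = b} :=
    (hX.measurableSet_eq a i).inter (hX.measurableSet_eq b (i + n))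
  rw [h, letterIndicator, letterIndicator, integral_indicator_one (hX.measurableSet_eq a i),
    integral_indicator_one (hX.measurableSet_eq b _), integral_indicator_one hm,
    hX.measureReal_pair hp, hX.measureReal_eq hp, hX.measureReal_eq hp]

theorem IsMarkovChain.memLp_centeredCount (hX : IsMarkovChain P p X μ) (a : Fin m) (k : ℕ) :
    MemLp (centeredCount p X a k) 2 μ := by
  rw [centeredCount_eq]
  exact (memLp_finsetSum' _ fun i _ => hX.memLp_letterIndicator a i).sub (memLp_const _)

theorem IsMarkovChain.covariance_centeredCount_eq (hX : IsMarkovChain P p X μ) (a b : Fin m)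
    (k : ℕ) : cov[centeredCount p X a k, centeredCount p X b k; μ] =
      ∑ i ∈ Finset.Icc 1 k, ∑ j ∈ Finset.Icc 1 k,
        cov[letterIndicator X a i, letterIndicator X b j; μ] := by
  have hi : ∀ a, Integrable (∑ i ∈ Finset.Icc 1 k, letterIndicator X a i) μ := fun a =>
    (memLp_finsetSum' _ fun i _ => hX.memLp_letterIndicator a i).integrable (by norm_num)
  rw [centeredCount_eq, centeredCount_eq, covariance_sub_const_left (hi a),
    covariance_sub_const_right (hi b), covariance_sum_sum' (fun i _ => hX.memLp_letterIndicator a i)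
      (fun i _ => hX.memLp_letterIndicator b i)]

/-- This is what a new time `k + 1` adds to the double sum of covariances; reflecting the range
indexes it by the time lag. -/
theorem IsMarkovChain.sum_covariance_letterIndicator (hX : IsMarkovChain P p X μ)
    (hp : IsStationaryDistribution P p) (k : ℕ) (a b : Fin m) :
    ∑ i ∈ Finset.Icc 1 k, cov[letterIndicator X a i, letterIndicator X b (k + 1); μ] =
      p a * ∑ n ∈ Finset.range k, (P ^ (n + 1)) a b - k * (p a * p b) := by
  rw [sum_Icc_one_eq_sum_range, ← Finset.sum_range_reflect, Finset.mul_sum]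
  have : ∀ j ∈ Finset.range k, cov[letterIndicator X a (k - 1 - j + 1),
      letterIndicator X b (k + 1); μ] = p a * (P ^ (j + 1)) a b - p a * p b := by
    intro j hj
    rw [Finset.mem_range] at hj
    rw [← hX.covariance_letterIndicator hp (k - 1 - j + 1)]
    congr 2
    omega
  rw [Finset.sum_congr rfl this, Finset.sum_sub_distrib]
  simp

/-- The limits that define the asymptotic covariance matrix exist. -/
theorem IsMarkovChain.tendsto_asymptoticCov (hX : IsMarkovChain P p X μ)
    (hP : P ∈ Matrix.rowStochastic ℝ (Fin m)) (hirr : P.IsIrreducible)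
    (hp : IsStationaryDistribution P p) (a b : Fin m) :
    Tendsto (fun k : ℕ => cov[centeredCount p X a k, centeredCount p X b k; μ] / (k : ℝ)) atTop
      (𝓝 (asymptoticCov p X μ a b)) := by
  -- `limUnder` is the limit as soon as some limit exists.
  refine tendsto_nhds_limUnder ?_
  let f (b c : Fin m) : ℝ := P c b - p b
  have hf : ∀ b, p ⬝ᵥ f b = 0 := by
    intro b
    have h1 := congrFun hp.vecMul_eq b
    have h2 := hp.mem_stdSimplex.2
    simp only [Matrix.vecMul, dotProduct] at h1
    simp only [dotProduct, f, mul_sub, Finset.sum_sub_distrib, h1, ← Finset.sum_mul, h2, one_mul,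
      sub_self]
  have hpow : ∀ a b n, (Matrix.mulVec (P ^ n) (f b)) a = (P ^ (n + 1)) a b - p b := by
    intro a b n
    have h2 := Matrix.sum_row_of_mem_rowStochastic (pow_mem hP n) a
    simp only [Matrix.mulVec, dotProduct, f, mul_sub, Finset.sum_sub_distrib, ← Finset.sum_mul, h2,
      one_mul, pow_succ, Matrix.mul_apply]
  have hv : ∀ (a b : Fin m) (k : ℕ),
      ∑ i ∈ Finset.Icc 1 k, cov[letterIndicator X a i, letterIndicator X b (k + 1); μ] =
        p a * ∑ n ∈ Finset.range k, (Matrix.mulVec (P ^ n) (f b)) a := by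
    intro a b k
    rw [hX.sum_covariance_letterIndicator hp]
    simp only [hpow, Finset.sum_sub_distrib, Finset.sum_const, Finset.card_range, nsmul_eq_mul]
    ring
  let c : ℝ := p a * (P ^ 0) a b - p a * p b
  -- Passing from `k` to `k + 1` adds a column, a row and the diagonal term `c`. Dividing by `k`
  -- thus gives Cesàro means of partial sums of `P ^ n f`, with `f` centered.
  have hstep : ∀ k : ℕ, cov[centeredCount p X a k, centeredCount p X b k; μ] =
      ∑ i ∈ Finset.range k, (p a * ∑ n ∈ Finset.range i, (Matrix.mulVec (P ^ n) (f b)) a +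
        p b * ∑ n ∈ Finset.range i, (Matrix.mulVec (P ^ n) (f a)) b + c) := by
    intro k
    rw [hX.covariance_centeredCount_eq]
    induction k with
    | zero => simp
    | succ k ih =>
      rw [Finset.sum_range_succ, ← ih, ← hv, ← hv]
      have hc : cov[letterIndicator X a (k + 1), letterIndicator X b (k + 1); μ] = c :=
        hX.covariance_letterIndicator hp (k + 1) 0 a b
      simp only [Finset.sum_Icc_succ_top (Nat.le_add_left 1 k), Finset.sum_add_distrib, hc]
      simp only [covariance_comm (letterIndicator X a (k + 1))]
      ring
  obtain ⟨l₁, h₁⟩ := exists_tendsto_cesaro_sum_pow_mulVec hP hirr hp (hf b) a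
  obtain ⟨l₂, h₂⟩ := exists_tendsto_cesaro_sum_pow_mulVec hP hirr hp (hf a) b
  refine ⟨p a * l₁ + p b * l₂ + c,
    (((h₁.const_mul (p a)).add (h₂.const_mul (p b))).add_const c).congr' ?_⟩
  filter_upwards [eventually_gt_atTop 0] with n hn
  have hn' : (n : ℝ) ≠ 0 := by positivity
  rw [hstep]
  simp only [Finset.sum_add_distrib, ← Finset.mul_sum, Finset.sum_const, Finset.card_range,
    nsmul_eq_mul]
  field_simp

theorem IsMarkovChain.sum_asymptoticCov (hX : IsMarkovChain P p X μ)
    (hP : P ∈ Matrix.rowStochastic ℝ (Fin m)) (hirr : P.IsIrreducible)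
    (hp : IsStationaryDistribution P p) (a : Fin m) : ∑ b, asymptoticCov p X μ a b = 0 := by
  refine tendsto_nhds_unique
    (tendsto_finsetSum Finset.univ fun b _ => hX.tendsto_asymptoticCov hP hirr hp a b) ?_
  refine tendsto_const_nhds.congr fun k => ?_
  rw [← Finset.sum_div, ← covariance_sum_right (fun b => hX.memLp_centeredCount b k)
    (hX.memLp_centeredCount a k), sum_centeredCount hp, covariance_zero_right, zero_div]

theorem IsMarkovChain.asymptoticCov_self_nonneg (hX : IsMarkovChain P p X μ)
    (hP : P ∈ Matrix.rowStochastic ℝ (Fin m)) (hirr : P.IsIrreducible)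
    (hp : IsStationaryDistribution P p) (a : Fin m) : 0 ≤ asymptoticCov p X μ a a := by
  refine ge_of_tendsto' (hX.tendsto_asymptoticCov hP hirr hp a a) fun k => ?_
  rw [covariance_self (hX.memLp_centeredCount a k).aemeasurable]
  exact div_nonneg (variance_nonneg _ _) k.cast_nonneg

/-- Cauchy–Schwarz survives the limit; it handles letters with `σ_a = 0`. -/
theorem IsMarkovChain.asymptoticCov_sq_le (hX : IsMarkovChain P p X μ)
    (hP : P ∈ Matrix.rowStochastic ℝ (Fin m)) (hirr : P.IsIrreducible)
    (hp : IsStationaryDistribution P p) (a b : Fin m) :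
    asymptoticCov p X μ a b ^ 2 ≤ asymptoticCov p X μ a a * asymptoticCov p X μ b b := by
  have h := hX.tendsto_asymptoticCov hP hirr hp
  refine le_of_tendsto_of_tendsto' ((h a b).pow 2) ((h a a).mul (h b b)) fun k => ?_
  rw [div_pow, div_mul_div_comm, ← sq]
  gcongr
  rw [covariance_self (hX.memLp_centeredCount a k).aemeasurable,
    covariance_self (hX.memLp_centeredCount b k).aemeasurable]
  exact covariance_sq_le_variance_mul_variance (hX.memLp_centeredCount a k)
    (hX.memLp_centeredCount b k)

end Chain

/-! ### Positions of the letters -/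

section Ranking

variable {m : ℕ} {p : Fin m → ℝ} {τ : Equiv.Perm (Fin m)}

theorem ranked_apply {α β : Type*} [Zero β] (τ : Equiv.Perm (Fin m)) (f : Fin m → α → β) (i : ℕ)
    (t : α) : ranked τ f i t = ranked τ (fun a => f a t) i := by
  unfold ranked
  split_ifs <;> rfl

theorem ranked_val_add_one {α : Type*} [Zero α] (τ : Equiv.Perm (Fin m)) (f : Fin m → α)
    (i : Fin m) : ranked τ f (i + 1) = f (τ i) := by
  rw [ranked, dif_pos ⟨by omega, by omega⟩]
  rfl

theorem exists_val_add_one_eq {i : ℕ} (hi : i ∈ Finset.Icc 1 m) : ∃ k : Fin m, (k : ℕ) + 1 = i := by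
  rw [Finset.mem_Icc] at hi
  exact ⟨⟨i - 1, by omega⟩, by simp only; omega⟩

theorem sum_ranked (τ : Equiv.Perm (Fin m)) (f : Fin m → ℝ) :
    ∑ i ∈ Finset.Icc 1 m, ranked τ f i = ∑ a, f a := by
  rw [sum_Icc_one_eq_sum_range, Finset.sum_range, ← Equiv.sum_comp τ f]
  exact Finset.sum_congr rfl fun i _ => ranked_val_add_one τ f i

theorem IsRanking.ranked_le (hτ : IsRanking p τ) {i j : ℕ} (hi : 1 ≤ i) (hij : i ≤ j) (hj : j ≤ m) :
    ranked τ p j ≤ ranked τ p i := by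
  obtain ⟨k, rfl⟩ := exists_val_add_one_eq (m := m) (i := i) (Finset.mem_Icc.2 ⟨hi, hij.trans hj⟩)
  obtain ⟨l, rfl⟩ := exists_val_add_one_eq (m := m) (i := j) (Finset.mem_Icc.2 ⟨hi.trans hij, hj⟩)
  rw [ranked_val_add_one, ranked_val_add_one]
  exact hτ.antitone k l (by rw [Fin.le_def]; omega)

/-- Probabilities decrease along the ranking, so the positions strictly above that of `r` form an
initial interval. -/
theorem IsRanking.lt_ranked_iff (hτ : IsRanking p τ) (r : ℕ) {i : ℕ} (hi : i ∈ Finset.Icc 1 m) :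
    ranked τ p r < ranked τ p i ↔ i ≤ lastAbove p τ r := by
  refine ⟨fun h => Finset.le_sup (f := id) (Finset.mem_filter.2 ⟨hi, h⟩), fun h => ?_⟩
  rw [Finset.mem_Icc] at hi
  have hne : ((Finset.Icc 1 m).filter fun i => ranked τ p r < ranked τ p i).Nonempty := by
    by_contra hne
    rw [Finset.not_nonempty_iff_eq_empty] at hne
    rw [lastAbove, hne] at h
    simp at h
    omega
  obtain ⟨j, hj, hj'⟩ := Finset.exists_mem_eq_sup _ hne id
  rw [Finset.mem_filter, Finset.mem_Icc] at hj
  exact hj.2.trans_le (hτ.ranked_le hi.1 (h.trans_eq hj') hj.1.2)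

theorem IsRanking.lastAbove_lt (hτ : IsRanking p τ) {r : ℕ} (hr : r ∈ Finset.Icc 1 m) :
    lastAbove p τ r < r := by
  rw [← not_le, ← hτ.lt_ranked_iff r hr]
  exact lt_irrefl _

theorem letterMultiplicity_eq_card (p : Fin m → ℝ) (τ : Equiv.Perm (Fin m)) (r : ℕ) :
    letterMultiplicity p τ r =
      ((Finset.Icc 1 m).filter fun i => ranked τ p i = ranked τ p r).card := by
  symm
  refine Finset.card_bij' (fun i hi => τ ⟨i - 1, ?_⟩) (fun a _ => (τ.symm a : ℕ) + 1) ?_ ?_ ?_ ?_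
  · rw [Finset.mem_filter, Finset.mem_Icc] at hi
    omega
  · intro i hi
    rw [Finset.mem_filter] at hi
    obtain ⟨k, rfl⟩ := exists_val_add_one_eq hi.1
    simpa [ranked_val_add_one] using hi.2
  · intro a ha
    rw [Finset.mem_filter] at ha
    rw [Finset.mem_filter, ranked_val_add_one, Finset.mem_Icc]
    exact ⟨⟨by omega, by omega⟩, by simpa using ha.2⟩
  · intro i hi
    rw [Finset.mem_filter, Finset.mem_Icc] at hi
    simp only [Equiv.symm_apply_apply]
    omega
  · intro a ha
    simp

/-- The letters with the probability of the `r`-th one fill an interval of positions after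
`lastAbove p τ r`, and `r` lies in it. -/
theorem IsRanking.lastAbove_add_letterMultiplicity (hτ : IsRanking p τ) {r : ℕ}
    (hr : r ∈ Finset.Icc 1 m) :
    r ≤ lastAbove p τ r + letterMultiplicity p τ r ∧
      lastAbove p τ r + letterMultiplicity p τ r ≤ m := by
  have hlt := hτ.lastAbove_lt hr
  have hr' := Finset.mem_Icc.1 hr
  rw [letterMultiplicity_eq_card]
  -- The multiplicity is bounded on both sides by the lengths of intervals starting just after
  -- `lastAbove`.
  have h1 : Finset.Icc (lastAbove p τ r + 1) r ⊆
      (Finset.Icc 1 m).filter fun i => ranked τ p i = ranked τ p r := by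
    intro i hi
    rw [Finset.mem_Icc] at hi
    have hi' : i ∈ Finset.Icc 1 m := Finset.mem_Icc.2 ⟨by omega, by omega⟩
    refine Finset.mem_filter.2 ⟨hi', le_antisymm (not_lt.1 ?_) ?_⟩
    · rw [hτ.lt_ranked_iff r hi']
      omega
    · exact hτ.ranked_le (by omega) hi.2 hr'.2
  have h2 : ((Finset.Icc 1 m).filter fun i => ranked τ p i = ranked τ p r) ⊆
      Finset.Icc (lastAbove p τ r + 1) m := by
    intro i hi
    rw [Finset.mem_filter] at hi
    have h := mt (hτ.lt_ranked_iff r hi.1).2 (by rw [hi.2]; exact lt_irrefl _)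
    rw [Finset.mem_Icc] at hi ⊢
    omega
  have h1 := Finset.card_le_card h1
  have h2 := Finset.card_le_card h2
  rw [Nat.card_Icc] at h1 h2
  omega

theorem sum_Icc_eq_add_add (f : ℕ → ℝ) {a d m : ℕ} (h : a + d ≤ m) :
    ∑ i ∈ Finset.Icc 1 m, f i = ∑ i ∈ Finset.Icc 1 a, f i + ∑ ℓ ∈ Finset.Icc 1 d, f (a + ℓ) +
      ∑ i ∈ Finset.Icc (a + d + 1) m, f i := by
  have hu : ∑ i ∈ Finset.Icc (a + d + 1) m, f i = ∑ i ∈ Finset.Ico (a + d) m, f (i + 1) := by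
    rw [Finset.sum_Ico_add' f]
    exact Finset.sum_congr (by ext; simp only [Finset.mem_Icc, Finset.mem_Ico]; omega) fun _ _ => rfl
  rw [hu, sum_Icc_one_eq_sum_range, sum_Icc_one_eq_sum_range, sum_Icc_one_eq_sum_range,
    ← Finset.sum_range_add_sum_Ico _ h, Finset.sum_range_add (fun k => f (k + 1))]
  simp only [add_assoc]

end Ranking

/-! ### Reversal of Brownian motion -/

section Reversal

variable {Ω : Type*} [MeasurableSpace Ω] {μ : Measure Ω} {m : ℕ}

/-- The process run backwards in time and started at `0`. -/
def reverseProcess (B : unitInterval → Ω → Fin m → ℝ) (t : unitInterval) (ω : Ω) (a : Fin m) : ℝ :=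
  B (unitInterval.symm t) ω a - B 1 ω a

/-- A centered Gaussian vector is determined in law by its covariances. -/
theorem map_eq_of_covariance_eq [IsProbabilityMeasure μ] {ι : Type*} [Fintype ι]
    {U V : Ω → ι → Fin m → ℝ} (hU : HasGaussianLaw U μ) (hV : HasGaussianLaw V μ)
    (hU0 : ∀ i a, ∫ ω, U ω i a ∂μ = 0) (hV0 : ∀ i a, ∫ ω, V ω i a ∂μ = 0)
    (h : ∀ i j a b, cov[fun ω => U ω i a, fun ω => U ω j b; μ] =
      cov[fun ω => V ω i a, fun ω => V ω j b; μ]) :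
    μ.map U = μ.map V := by
  classical
  have hL2 : ∀ {U : Ω → ι → Fin m → ℝ}, HasGaussianLaw U μ → ∀ q : ι × Fin m,
      MemLp (fun ω => U ω q.1 q.2) 2 μ := fun hU q =>
    ((hU.map_fun (ContinuousLinearMap.proj q.1)).map_fun (ContinuousLinearMap.proj q.2)).memLp_two
  have hexp : ∀ (L : StrongDual ℝ (ι → Fin m → ℝ)) (v : ι → Fin m → ℝ),
      L v = ∑ q : ι × Fin m, L (Pi.single q.1 (Pi.single q.2 1)) * v q.1 q.2 := by
    intro L v
    have hv : v = ∑ q : ι × Fin m, v q.1 q.2 • Pi.single q.1 (Pi.single q.2 (1 : ℝ)) := by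
      ext i a
      simp [Fintype.sum_prod_type, Finset.sum_apply, Pi.single_apply, Finset.sum_ite_eq,
        apply_ite, ite_apply]
    -- The characteristic function sees only the mean and variance of each functional `L`; in
    -- coordinates these are given by the means and covariances of the entries.
    conv_lhs => rw [hv]
    simp [mul_comm]
  have hU' := hU.isGaussian_map
  have hV' := hV.isGaussian_map
  refine Measure.ext_of_charFunDual ?_
  ext L
  have hi : ∀ {U : Ω → ι → Fin m → ℝ}, HasGaussianLaw U μ → (∀ i a, ∫ ω, U ω i a ∂μ = 0) →
      ∫ ω, L (U ω) ∂μ = 0 := by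
    intro U hU hU0
    simp only [hexp L (U _)]
    rw [integral_finsetSum _ fun q _ => ((hL2 hU q).integrable (by norm_num)).const_mul _]
    simp [integral_const_mul, hU0]
  have hvar : ∀ {U : Ω → ι → Fin m → ℝ}, HasGaussianLaw U μ → Var[fun ω => L (U ω); μ] =
      ∑ q : ι × Fin m, ∑ q' : ι × Fin m, L (Pi.single q'.1 (Pi.single q'.2 1)) *
        (L (Pi.single q.1 (Pi.single q.2 1)) *
          cov[fun ω => U ω q.1 q.2, fun ω => U ω q'.1 q'.2; μ]) := by
    intro U hU
    simp only [hexp L (U _)]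
    rw [variance_fun_sum fun q => (hL2 hU q).const_mul _]
    simp only [covariance_const_mul_left, covariance_const_mul_right]
  rw [hU.charFunDual_map_eq_fun, hV.charFunDual_map_eq_fun, hi hU hU0, hi hV hV0, hvar hU, hvar hV]
  simp only [h]

variable {C : Matrix (Fin m) (Fin m) ℝ} {B : unitInterval → Ω → Fin m → ℝ}

theorem IsBrownianMotionWithCov.memLp (hB : IsBrownianMotionWithCov C B μ) (t : unitInterval)
    (a : Fin m) : MemLp (fun ω => B t ω a) 2 μ :=
  ((hB.gaussian.hasGaussianLaw_eval t).map_fun (ContinuousLinearMap.proj a)).memLp_two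

variable [IsProbabilityMeasure μ]

/-- The covariance rests on `min(1-s, 1-t) - (1-s) - (1-t) + 1 = min(s, t)`. -/
theorem IsBrownianMotionWithCov.reverse (hB : IsBrownianMotionWithCov C B μ) :
    IsBrownianMotionWithCov C (reverseProcess B) μ where
  gaussian := by
    classical
    refine hB.gaussian.of_isGaussianProcess fun t => ⟨{unitInterval.symm t, 1},
      ContinuousLinearMap.proj ⟨unitInterval.symm t, by simp⟩ -
        ContinuousLinearMap.proj ⟨1, by simp⟩, fun ω => ?_⟩
    ext a
    simp [reverseProcess]
  centered t a := by
    simp only [reverseProcess]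
    rw [integral_sub ((hB.memLp _ a).integrable (by norm_num))
      ((hB.memLp _ a).integrable (by norm_num)), hB.centered, hB.centered, sub_zero]
  covariance s t a b := by
    simp only [reverseProcess]
    rw [covariance_fun_sub_fun_sub (hB.memLp _ a) (hB.memLp _ a) (hB.memLp _ b) (hB.memLp _ b)]
    simp only [hB.covariance, unitInterval.coe_symm_eq, Set.Icc.coe_one, ← sub_mul, ← add_mul]
    congr 1
    have h1 := s.2.1
    have h2 := t.2.1
    rcases le_total (s : ℝ) t with h | h
    · rw [min_eq_left h, min_eq_right (by linarith), min_eq_left (by linarith),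
        min_eq_right (by linarith), min_self]
      ring
    · rw [min_eq_right h, min_eq_left (by linarith), min_eq_left (by linarith),
        min_eq_right (by linarith), min_self]
      ring
  continuous := by
    filter_upwards [hB.continuous] with ω hω
    refine continuous_pi fun a => ?_
    have h := (continuous_apply a).comp hω
    exact (h.comp unitInterval.continuous_symm).sub continuous_const

/-- Two Brownian motions with the same covariance matrix have the same law along countably many
times. -/
theorem IsBrownianMotionWithCov.identDistrib {B' : unitInterval → Ω → Fin m → ℝ}
    (hB : IsBrownianMotionWithCov C B μ) (hB' : IsBrownianMotionWithCov C B' μ)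
    {T : Type*} [Countable T] (q : T → unitInterval) :
    IdentDistrib (fun ω i => B (q i) ω) (fun ω i => B' (q i) ω) μ μ := by
  have hm : ∀ {B : unitInterval → Ω → Fin m → ℝ}, IsBrownianMotionWithCov C B μ →
      AEMeasurable (fun ω i => B (q i) ω) μ := fun hB =>
    aemeasurable_pi_lambda _ fun i => hB.gaussian.aemeasurable (q i)
  refine ⟨hm hB, hm hB', ?_⟩
  refine (map_eq_iff_forall_finset_map_restrict_eq (X := fun i => B (q i))
    (Y := fun i => B' (q i)) (hm hB) (hm hB')).2 fun I => ?_
  exact map_eq_of_covariance_eq ((hB.gaussian.comp_right q).hasGaussianLaw I)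
    ((hB'.gaussian.comp_right q).hasGaussianLaw I) (fun i a => hB.centered _ a)
    (fun i a => hB'.centered _ a) fun i j a b =>
      (hB.covariance (q i) (q j) a b).trans (hB'.covariance (q i) (q j) a b).symm

theorem IsBrownianMotionWithCov.zero_ae (hB : IsBrownianMotionWithCov C B μ) :
    ∀ᵐ ω ∂μ, ∀ a, B 0 ω a = 0 := by
  rw [ae_all_iff]
  intro a
  have h : Var[fun ω => B 0 ω a; μ] = 0 := by
    rw [← covariance_self (hB.memLp 0 a).aemeasurable, hB.covariance]
    simp
  filter_upwards [ae_eq_integral_of_variance_eq_zero (hB.memLp 0 a) h] with ω hω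
  rw [hω, hB.centered]

/-- The double sum in `hc` is the variance of the combination, which is centered. -/
theorem IsBrownianMotionWithCov.sum_mul_ae (hB : IsBrownianMotionWithCov C B μ) (c : Fin m → ℝ)
    (hc : ∑ a, ∑ b, c a * c b * C a b = 0) : ∀ᵐ ω ∂μ, ∑ a, c a * B 1 ω a = 0 := by
  have hL : ∀ a, MemLp (fun ω => c a * B 1 ω a) 2 μ := fun a => (hB.memLp 1 a).const_mul (c a)
  have h : Var[fun ω => ∑ a, c a * B 1 ω a; μ] = 0 := by
    rw [variance_fun_sum hL, ← hc]
    refine Finset.sum_congr rfl fun a _ => Finset.sum_congr rfl fun b _ => ?_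
    rw [covariance_const_mul_left, covariance_const_mul_right, hB.covariance]
    simp [mul_assoc]
  filter_upwards [ae_eq_integral_of_variance_eq_zero (memLp_finsetSum _ fun a _ => hL a) h]
    with ω hω
  rw [hω, integral_finsetSum _ fun a _ => (hL a).integrable (by norm_num)]
  simp [integral_const_mul, hB.centered]

end Reversal

/-! ### The functionals -/

section Functionals

variable {Ω : Type*} {m : ℕ}

theorem rankedPath_apply (sd : Fin m → ℝ) (τ : Equiv.Perm (Fin m))
    (B : unitInterval → Ω → Fin m → ℝ) (ω : Ω) (i : ℕ) (t : unitInterval) :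
    rankedPath sd τ B ω i t = ranked τ (fun a => sd a * B t ω a) i :=
  ranked_apply τ _ i t

theorem continuous_rankedPath (sd : Fin m → ℝ) (τ : Equiv.Perm (Fin m))
    {B : unitInterval → Ω → Fin m → ℝ} {ω : Ω} (hB : Continuous fun t => B t ω) (i : ℕ) :
    Continuous (rankedPath sd τ B ω i) := by
  unfold rankedPath ranked
  split_ifs
  · exact continuous_const.mul ((continuous_apply _).comp hB)
  · exact continuous_const

theorem rankedPath_reverseProcess (sd : Fin m → ℝ) (τ : Equiv.Perm (Fin m))
    (B : unitInterval → Ω → Fin m → ℝ) (ω : Ω) (i : ℕ) :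
    rankedPath sd τ (reverseProcess B) ω i = reversePath (rankedPath sd τ B ω i) := by
  ext t
  simp only [reversePath, rankedPath_apply, ranked, reverseProcess]
  split_ifs <;> ring

/-- If all letters together do not move, the limiting functional is the mirrored functional of the
reversed process. -/
theorem limitFunctional_eq_mirrorFunctional_reverseProcess {p : Fin m → ℝ}
    {τ : Equiv.Perm (Fin m)} (hτ : IsRanking p τ) (sd : Fin m → ℝ)
    {B : unitInterval → Ω → Fin m → ℝ} {ω : Ω} {r : ℕ} (hr : r ∈ Finset.Icc 1 m)
    (hc : Continuous fun t => B t ω) (h0 : ∀ a, B 0 ω a = 0) (h1 : ∑ a, sd a * B 1 ω a = 0) :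
    limitFunctional p sd τ B r ω = mirrorFunctional p sd τ (reverseProcess B) r ω := by
  obtain ⟨hle, hm⟩ := hτ.lastAbove_add_letterMultiplicity hr
  have hlt := hτ.lastAbove_lt hr
  rw [limitFunctional, mirrorFunctional,
    staircaseMax_complement (by omega) fun ℓ => continuous_rankedPath sd τ hc _]
  simp only [rankedPath_reverseProcess]
  rw [show letterMultiplicity p τ r - (r - lastAbove p τ r) =
    lastAbove p τ r + letterMultiplicity p τ r - r by omega, ← add_assoc]
  congr 1
  have hz : ∀ i, rankedPath sd τ B ω i 0 = 0 := fun i => by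
    simp [rankedPath_apply, ranked, h0]
  -- The vanishing sum over all letters splits into larger, tied and smaller ones; reversal flips
  -- the sign of the last block.
  have hs := sum_Icc_eq_add_add (fun i => rankedPath sd τ B ω i 1) hm
  simp only [rankedPath_apply] at hs
  rw [sum_ranked, h1] at hs
  simp only [reversePath, unitInterval.symm_one, hz, zero_sub, sub_zero, Finset.sum_neg_distrib]
  simp only [rankedPath_apply]
  linarith

/-- The mirrored functional depends measurably on the values of a continuous process at countably
many times. -/
theorem exists_measurable_mirrorFunctional {p : Fin m → ℝ} {τ : Equiv.Perm (Fin m)}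
    (hτ : IsRanking p τ) (sd : Fin m → ℝ) {r : ℕ} (hr : r ∈ Finset.Icc 1 m) :
    ∃ (q : Option (ℕ × ℕ × ℕ) → unitInterval) (Φ : (Option (ℕ × ℕ × ℕ) → Fin m → ℝ) → ℝ),
      Measurable Φ ∧ ∀ (B : unitInterval → Ω → Fin m → ℝ) (ω : Ω), Continuous (fun t => B t ω) →
        mirrorFunctional p sd τ B r ω = Φ fun i => B (q i) ω := by
  have hlt := hτ.lastAbove_lt hr
  set M := lastAbove p τ r with hM
  set d := letterMultiplicity p τ r with hd
  set s := M + d - r with hs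
  have : Nonempty (staircase s d) := (staircase_nonempty (by omega)).to_subtype
  let u : ℕ → staircase s d := TopologicalSpace.denseSeq _
  have hrk : ∀ (i : ℕ) (k : Option (ℕ × ℕ × ℕ)), Measurable
      fun y : Option (ℕ × ℕ × ℕ) → Fin m → ℝ => ranked τ (fun a => sd a * y k a) i := by
    intro i k
    unfold ranked
    split_ifs
    · exact measurable_const.mul ((measurable_pi_apply _).comp (measurable_pi_apply k))
    · exact measurable_const
  -- Index `none` stands for time `1`, and `some (n, j, ℓ)` for entry `(j, ℓ)` of the `n`-th array
  -- in a dense sequence of the staircase.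
  refine ⟨fun k => k.elim 1 fun k => (u k.1).1 k.2.1 k.2.2,
    fun y => ∑ i ∈ Finset.Icc (M + d + 1) m, ranked τ (fun a => sd a * y none a) i +
      ⨆ n, ∑ j ∈ Finset.Icc 1 s, ∑ ℓ ∈ Finset.Icc j (d - s + j),
        (ranked τ (fun a => sd a * y (some (n, j, ℓ)) a) (M + ℓ) -
          ranked τ (fun a => sd a * y (some (n, j, ℓ - 1)) a) (M + ℓ)), ?_, fun B ω hc => ?_⟩
  · refine (Finset.measurable_fun_sum _ fun i _ => hrk i none).add (Measurable.iSup fun n =>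
      Finset.measurable_fun_sum _ fun j _ => Finset.measurable_fun_sum _ fun ℓ _ =>
        (hrk _ _).sub (hrk _ _))
  · have hx : ∀ ℓ, Continuous (rankedPath sd τ B ω (M + ℓ)) := fun ℓ =>
      continuous_rankedPath sd τ hc _
    rw [mirrorFunctional, staircaseMax_eq_sSup, sSup_image_eq_iSup_denseSeq _
      (continuous_staircaseSum _ _ hx) (bddAbove_staircaseSum _ _ hx)]
    simp only [staircaseSum, rankedPath_apply]
    rfl

end Functionals

/-! ### Degeneracy of the covariance and conclusion. -/

/-- Each summand is `S a b`, even when `σ_a σ_b = 0`: the quotient then defaults to `0`, and `hS`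
forces `S a b = 0` as well. -/
theorem sum_stdDev_mul_correlation {m : ℕ} {S : Matrix (Fin m) (Fin m) ℝ}
    (hd : ∀ a, 0 ≤ S a a) (hS : ∀ a b, S a b ^ 2 ≤ S a a * S b b) (h0 : ∀ a, ∑ b, S a b = 0) :
    ∑ a, ∑ b, stdDev S a * stdDev S b * correlation S a b = 0 := by
  refine Finset.sum_eq_zero fun a _ => ?_
  rw [← h0 a]
  refine Finset.sum_congr rfl fun b _ => ?_
  rw [correlation, Matrix.of_apply]
  rcases eq_or_ne (stdDev S a * stdDev S b) 0 with h | h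
  · rw [h, zero_mul]
    have h1 : S a a * S b b = 0 := by
      rw [stdDev, stdDev, ← Real.sqrt_mul (hd a)] at h
      exact (Real.sqrt_eq_zero (mul_nonneg (hd a) (hd b))).1 h
    exact (pow_eq_zero_iff two_ne_zero).1 (le_antisymm ((hS a b).trans_eq h1) (sq_nonneg _)) |>.symm
  · exact mul_div_cancel₀ _ h

theorem theorem6 {Ω Ω' : Type*} [MeasurableSpace Ω] [MeasurableSpace Ω']
    (μ : MeasureTheory.Measure Ω) [MeasureTheory.IsProbabilityMeasure μ]
    (μ' : MeasureTheory.Measure Ω') [MeasureTheory.IsProbabilityMeasure μ']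
    (m : ℕ) (P : Matrix (Fin m) (Fin m) ℝ) (p : Fin m → ℝ) (X : ℕ → Ω → Fin m)
    (hP : P ∈ Matrix.rowStochastic ℝ (Fin m))
    (hirr : P.IsIrreducible) (haper : IsAperiodic P)
    (hp : IsStationaryDistribution P p) (hX : IsMarkovChain P p X μ)
    (τ : Equiv.Perm (Fin m)) (hτ : IsRanking p τ)
    (B : unitInterval → Ω' → Fin m → ℝ)
    (hB : IsBrownianMotionWithCov (correlation (asymptoticCov p X μ)) B μ')
    (r : ℕ) (hr : 1 ≤ r) (hrm : r ≤ m - 1) :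
    ProbabilityTheory.IdentDistrib
      (limitFunctional p (stdDev (asymptoticCov p X μ)) τ B r)
      (mirrorFunctional p (stdDev (asymptoticCov p X μ)) τ B r) μ' μ' := by
  have hr' : r ∈ Finset.Icc 1 m := Finset.mem_Icc.2 ⟨hr, by omega⟩
  obtain ⟨q, Φ, hΦ, hmir⟩ := exists_measurable_mirrorFunctional (Ω := Ω') hτ
    (stdDev (asymptoticCov p X μ)) hr'
  -- Only this step is an identity in law; the two functionals agree almost surely with its two
  -- sides.
  have hid := (hB.reverse.identDistrib hB q).comp hΦ
  have hl : Φ ∘ (fun ω i => reverseProcess B (q i) ω) =ᵐ[μ']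
      limitFunctional p (stdDev (asymptoticCov p X μ)) τ B r := by
    filter_upwards [hB.continuous, hB.reverse.continuous, hB.zero_ae,
      hB.sum_mul_ae _ (sum_stdDev_mul_correlation (hX.asymptoticCov_self_nonneg hP hirr hp)
        (hX.asymptoticCov_sq_le hP hirr hp) (hX.sum_asymptoticCov hP hirr hp))] with ω hc hc' h0 h1
    rw [limitFunctional_eq_mirrorFunctional_reverseProcess hτ _ hr' hc h0 h1, hmir _ ω hc']
    rfl
  have hright : Φ ∘ (fun ω i => B (q i) ω) =ᵐ[μ']
      mirrorFunctional p (stdDev (asymptoticCov p X μ)) τ B r := by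
    filter_upwards [hB.continuous] with ω hc
    rw [hmir _ ω hc]
    rfl
  exact ((IdentDistrib.of_ae_eq hid.aemeasurable_fst hl).symm.trans hid).trans
    (IdentDistrib.of_ae_eq hid.aemeasurable_snd hright)
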